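/- Let $V$ be a real normed space (of arbitrary, possibly infinite, dimension) and let $W$ be a finite-dimensional real normed space. Then the following conditions are equivalent: 1. $V$ and $W$ are linearly isometric, i.e. there is a surjective linear isometry $V\to W$; 2. $\dim W\le\dim V$ and there is an isometric (i.e. distance-preserving, not necessarily linear) embedding $f\colon B_V\to W$ of the closed unit ball $B_V=\{v\in V:\|v\|\le 1\}$ into $W$; 3. $V$ and $W$ have the same compact subsets up to isometry, i.e. every compact subset of $V$ is isometric to a compact subset of $W$ and every compact subset of $W$ is isometric to a compact subset of $V$; 4. $\dim W\le\dim V$ and every finite subset of $V$, with the induced metric, embeds isometrically in $W$. -/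

import Mathlib

universe u v

/-- Two metric spaces have the same compact subsets up to isometry: every compact subset of either
space is isometric to some compact subset of the other. -/
def SameCompactSubsets (X Y : Type*) [MetricSpace X] [MetricSpace Y] : Prop :=
  (∀ K : Set X, IsCompact K → ∃ L : Set Y, IsCompact L ∧ Nonempty (K ≃ᵢ L)) ∧
    (∀ L : Set Y, IsCompact L → ∃ K : Set X, IsCompact K ∧ Nonempty (L ≃ᵢ K))

/-! Finite subsets control everything: since `W` is proper, an ultralimit of embeddings of finite
subsets embeds all of `V`. An embedded unit ball forces `V` to be finite-dimensional, by Riesz's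
lemma. Rademacher's theorem then gives an interior point of differentiability, where the derivative
is a linear isometry, and the dimension inequality makes it surjective. -/

open Filter Topology Metric in
/-- The derivative of a map that preserves distances near the point of differentiability preserves
norms. -/
theorem HasFDerivAt.norm_map_of_eventually_dist_eq {E F : Type*}
    [NormedAddCommGroup E] [NormedSpace ℝ E] [NormedAddCommGroup F] [NormedSpace ℝ F]
    {f : E → F} {L : E →L[ℝ] F} {x : E} (hL : HasFDerivAt f L x)
    (hf : ∀ᶠ y in 𝓝 x, dist (f y) (f x) = dist y x) (v : E) : ‖L v‖ = ‖v‖ := by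
  have hlim := (hL.hasLineDerivAt v).tendsto_slope_zero.norm
  refine tendsto_nhds_unique hlim (tendsto_const_nhds.congr' ?_)
  have hcont : Tendsto (fun t : ℝ => x + t • v) (𝓝[≠] 0) (𝓝 x) := by
    have h : Continuous fun t : ℝ => x + t • v := by fun_prop
    simpa using (h.tendsto 0).mono_left nhdsWithin_le_nhds
  filter_upwards [hcont.eventually hf, self_mem_nhdsWithin] with t ht ht0
  have ht0 : t ≠ 0 := ht0
  rw [norm_smul, ← dist_eq_norm, ht, dist_eq_norm, add_sub_cancel_left, norm_smul, norm_inv,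
    inv_mul_cancel_left₀ (norm_ne_zero_iff.2 ht0)]

open Filter Topology Metric in
/-- An isometric embedding of the unit ball of a finite-dimensional space into a finite-dimensional
space can be linearized, by Rademacher's theorem. -/
theorem exists_linearIsometry_of_isometry_closedBall {E F : Type*}
    [NormedAddCommGroup E] [NormedSpace ℝ E] [FiniteDimensional ℝ E]
    [NormedAddCommGroup F] [NormedSpace ℝ F] [FiniteDimensional ℝ F]
    {f : closedBall (0 : E) 1 → F} (hf : Isometry f) : Nonempty (E →ₗᵢ[ℝ] F) := by
  let g : E → F := Function.extend Subtype.val f 0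
  have hg : ∀ x ∈ closedBall (0 : E) 1, ∀ y ∈ closedBall (0 : E) 1,
      dist (g x) (g y) = dist x y := by
    intro x hx y hy
    have hgf : ∀ z : closedBall (0 : E) 1, g z = f z :=
      fun z => Subtype.val_injective.extend_apply f 0 z
    rw [hgf ⟨x, hx⟩, hgf ⟨y, hy⟩, hf.dist_eq, Subtype.dist_eq]
  have hlip : LipschitzOnWith 1 g (closedBall 0 1) :=
    LipschitzOnWith.of_dist_le_mul fun x hx y hy => by simp [hg x hx y hy]
  borelize E
  -- A set of full measure is dense, so it meets the open ball; at an interior point,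
  -- differentiability within the ball is differentiability.
  obtain ⟨x, hx, hdiff⟩ : ∃ x ∈ ball (0 : E) 1,
      x ∈ closedBall (0 : E) 1 → DifferentiableWithinAt ℝ g (closedBall 0 1) x := by
    have hae := hlip.ae_differentiableWithinAt_of_mem (μ := MeasureTheory.Measure.addHaar)
    exact (MeasureTheory.Measure.dense_of_ae hae).inter_open_nonempty _ isOpen_ball
      ⟨0, mem_ball_self one_pos⟩
  have hnhds : closedBall (0 : E) 1 ∈ 𝓝 x :=
    mem_of_superset (isOpen_ball.mem_nhds hx) ball_subset_closedBall
  have hxc := ball_subset_closedBall hx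
  have hder := ((hdiff hxc).differentiableAt hnhds).hasFDerivAt
  exact ⟨⟨(fderiv ℝ g x).toLinearMap, hder.norm_map_of_eventually_dist_eq <| by
    filter_upwards [hnhds] with y hy using hg y hy x hxc⟩⟩

open Filter Topology Metric in
/-- A normed space whose unit ball embeds isometrically in a finite-dimensional space is
finite-dimensional. -/
theorem finiteDimensional_of_isometry_closedBall {E F : Type*}
    [NormedAddCommGroup E] [NormedSpace ℝ E]
    [NormedAddCommGroup F] [NormedSpace ℝ F] [FiniteDimensional ℝ F]
    {f : closedBall (0 : E) 1 → F} (hf : Isometry f) : FiniteDimensional ℝ E := by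
  by_contra hE
  obtain ⟨R, u, hR, hu, hsep⟩ := exists_seq_norm_le_one_le_norm_sub (𝕜 := ℝ) hE
  have hR0 : 0 < R := one_pos.trans hR
  -- Rescaling puts Riesz's 1-separated sequence into the unit ball, leaving it `R⁻¹`-separated; its
  -- bounded image then has no Cauchy subsequence.
  let w : ℕ → closedBall (0 : E) 1 := fun n => ⟨R⁻¹ • u n, by
    rw [mem_closedBall_zero_iff, norm_smul, norm_inv, Real.norm_of_nonneg hR0.le,
      inv_mul_le_iff₀ hR0, mul_one]
    exact hu n⟩
  have hdist : ∀ m n, dist (f (w m)) (f (w n)) = R⁻¹ * ‖u m - u n‖ := fun m n => by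
    rw [hf.dist_eq, Subtype.dist_eq, dist_eq_norm, ← smul_sub, norm_smul, norm_inv,
      Real.norm_of_nonneg hR0.le]
  have hbdd : Bornology.IsBounded (Set.range f) := by
    rw [← Set.image_univ]
    exact hf.lipschitz.isBounded_image <| Bornology.isBounded_image_subtype_val.1 <|
      isBounded_closedBall.subset (Subtype.coe_image_subset _ _)
  have : ProperSpace F := FiniteDimensional.proper ℝ F
  obtain ⟨a, -, φ, hφ, hlim⟩ :=
    tendsto_subseq_of_bounded hbdd (x := f ∘ w) fun n => Set.mem_range_self (w n)
  obtain ⟨N, hN⟩ := Metric.cauchySeq_iff.1 hlim.cauchySeq R⁻¹ (inv_pos.2 hR0)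
  have hlt : dist (f (w (φ (N + 1)))) (f (w (φ N))) < R⁻¹ := hN _ N.le_succ _ le_rfl
  rw [hdist] at hlt
  exact hlt.not_ge <| le_mul_of_one_le_right (inv_pos.2 hR0).le <|
    hsep (hφ.injective.ne N.succ_ne_self)

open Filter Topology Metric in
/-- If all finite subsets of a metric space embed isometrically in a proper normed group, then so
does the whole space. -/
theorem exists_isometry_of_finite {X F : Type*} [MetricSpace X] [NormedAddCommGroup F]
    [ProperSpace F] (h : ∀ S : Set X, S.Finite → ∃ f : S → F, Isometry f) :
    ∃ f : X → F, Isometry f := by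
  classical
  rcases isEmpty_or_nonempty X with hX | ⟨⟨o⟩⟩
  · exact ⟨fun _ => 0, fun x => hX.elim x⟩
  -- Pinning `o` to 0 confines the values at each `x` to a compact ball independent of `S`.
  have hfin : ∀ S : Finset X, ∃ g : X → F, (o ∈ S → g o = 0) ∧
      ∀ x ∈ S, ∀ y ∈ S, dist (g x) (g y) = dist x y := by
    intro S
    obtain ⟨f, hf⟩ := h S S.finite_toSet
    let g : X → F := Function.extend Subtype.val f 0
    have hgf : ∀ x ∈ S, ∀ y ∈ S, dist (g x) (g y) = dist x y := by
      intro x hx y hy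
      have hgf : ∀ z : (S : Set X), g z = f z :=
        fun z => Subtype.val_injective.extend_apply f 0 z
      rw [hgf ⟨x, hx⟩, hgf ⟨y, hy⟩, hf.dist_eq, Subtype.dist_eq]
    exact ⟨fun x => g x - g o, fun _ => sub_self _, fun x hx y hy => by
      rw [dist_sub_right, hgf x hx y hy]⟩
  choose g hg0 hg using hfin
  let l : Ultrafilter (Finset X) := Ultrafilter.of atTop
  have hl : (l : Filter (Finset X)) ≤ atTop := Ultrafilter.of_le _
  have hmem : ∀ x, ∀ᶠ S : Finset X in l, x ∈ S := fun x =>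
    hl <| (eventually_ge_atTop {x}).mono fun S hS => hS (Finset.mem_singleton_self x)
  have hlim : ∀ x, ∃ a : F, Tendsto (fun S => g S x) l (𝓝 a) := by
    intro x
    have hball : ∀ᶠ S : Finset X in l, g S x ∈ closedBall (0 : F) (dist x o) := by
      filter_upwards [hmem x, hmem o] with S hx ho
      rw [mem_closedBall, ← hg0 S ho, hg S x hx o ho]
    obtain ⟨a, -, ha⟩ := (isCompact_closedBall (0 : F) (dist x o)).ultrafilter_le_nhds
      (l.map fun S => g S x) (le_principal_iff.2 hball)
    exact ⟨a, ha⟩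
  choose G hG using hlim
  refine ⟨G, Isometry.of_dist_eq fun x y => ?_⟩
  refine tendsto_nhds_unique ((hG x).dist (hG y)) (tendsto_const_nhds.congr' ?_)
  filter_upwards [hmem x, hmem y] with S hx hy using (hg S x hx y hy).symm

/-- A normed space whose unit ball embeds isometrically in a finite-dimensional space of at most the
same dimension is linearly isometric to it. -/
theorem nonempty_linearIsometryEquiv_of_isometry_closedBall {E : Type u} {F : Type v}
    [NormedAddCommGroup E] [NormedSpace ℝ E]
    [NormedAddCommGroup F] [NormedSpace ℝ F] [FiniteDimensional ℝ F]
    (hrank : Cardinal.lift.{u} (Module.rank ℝ F) ≤ Cardinal.lift.{v} (Module.rank ℝ E))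
    {f : Metric.closedBall (0 : E) 1 → F} (hf : Isometry f) : Nonempty (E ≃ₗᵢ[ℝ] F) := by
  have := finiteDimensional_of_isometry_closedBall hf
  obtain ⟨L⟩ := exists_linearIsometry_of_isometry_closedBall hf
  refine ⟨L.toLinearIsometryEquiv
    (le_antisymm (LinearMap.finrank_le_finrank_of_injective (f := L.toLinearMap) L.injective) ?_)⟩
  rw [← Module.finrank_eq_rank, ← Module.finrank_eq_rank, Cardinal.lift_natCast,
    Cardinal.lift_natCast] at hrank
  exact_mod_cast hrank

theorem IsometryEquiv.exists_isCompact_isometryEquiv {X Y : Type*} [MetricSpace X] [MetricSpace Y]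
    (e : X ≃ᵢ Y) {K : Set X} (hK : IsCompact K) :
    ∃ L : Set Y, IsCompact L ∧ Nonempty (K ≃ᵢ L) :=
  ⟨e '' K, hK.image e.continuous, ⟨e.toEquiv.image K, e.isometry.comp isometry_subtype_coe⟩⟩

theorem SameCompactSubsets.of_isometryEquiv {X Y : Type*} [MetricSpace X] [MetricSpace Y]
    (e : X ≃ᵢ Y) : SameCompactSubsets X Y :=
  ⟨fun _ => e.exists_isCompact_isometryEquiv, fun _ => e.symm.exists_isCompact_isometryEquiv⟩

theorem SameCompactSubsets.exists_isometry_of_finite {X Y : Type*} [MetricSpace X] [MetricSpace Y]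
    (h : SameCompactSubsets X Y) (S : Set X) (hS : S.Finite) : ∃ f : S → Y, Isometry f := by
  obtain ⟨L, -, ⟨e⟩⟩ := h.1 S hS.isCompact
  exact ⟨_, isometry_subtype_coe.comp e.isometry⟩

/-- If a finite-dimensional space `W` has the same compact subsets as `V`, its dimension is at most
that of `V`. -/
theorem SameCompactSubsets.lift_rank_le {V : Type u} [NormedAddCommGroup V] [NormedSpace ℝ V]
    {W : Type v} [NormedAddCommGroup W] [NormedSpace ℝ W] [FiniteDimensional ℝ W]
    (h : SameCompactSubsets V W) :
    Cardinal.lift.{u} (Module.rank ℝ W) ≤ Cardinal.lift.{v} (Module.rank ℝ V) := by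
  have : ProperSpace W := FiniteDimensional.proper ℝ W
  obtain ⟨g, hg⟩ := _root_.exists_isometry_of_finite h.exists_isometry_of_finite
  -- Below, `V` is the target of the linearization, which must be finite-dimensional.
  have : FiniteDimensional ℝ V :=
    finiteDimensional_of_isometry_closedBall (hg.comp isometry_subtype_coe)
  obtain ⟨K, -, ⟨e⟩⟩ := h.2 _ (isCompact_closedBall (0 : W) 1)
  obtain ⟨L⟩ := exists_linearIsometry_of_isometry_closedBall
    (isometry_subtype_coe.comp e.isometry)
  exact LinearMap.lift_rank_le_of_injective L.toLinearMap L.injective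

theorem mainTheorem5
    (V : Type u) [NormedAddCommGroup V] [NormedSpace ℝ V]
    (W : Type v) [NormedAddCommGroup W] [NormedSpace ℝ W] [FiniteDimensional ℝ W] :
    List.TFAE [
      Nonempty (V ≃ₗᵢ[ℝ] W),
      Cardinal.lift.{u} (Module.rank ℝ W) ≤ Cardinal.lift.{v} (Module.rank ℝ V) ∧
        ∃ f : Metric.closedBall (0 : V) 1 → W, Isometry f,
      SameCompactSubsets V W,
      Cardinal.lift.{u} (Module.rank ℝ W) ≤ Cardinal.lift.{v} (Module.rank ℝ V) ∧
        ∀ S : Set V, S.Finite → ∃ f : S → W, Isometry f] := by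
  have : ProperSpace W := FiniteDimensional.proper ℝ W
  tfae_have 1 → 3 := fun ⟨e⟩ => .of_isometryEquiv e.toIsometryEquiv
  tfae_have 3 → 4 := fun h => ⟨h.lift_rank_le, h.exists_isometry_of_finite⟩
  tfae_have 4 → 2 := fun ⟨hrank, h⟩ =>
    have ⟨_, hg⟩ := exists_isometry_of_finite h
    ⟨hrank, _, hg.comp isometry_subtype_coe⟩
  tfae_have 2 → 1 := fun ⟨hrank, _, hf⟩ =>
    nonempty_linearIsometryEquiv_of_isometry_closedBall hrank hf
  tfae_finish
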